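/- Fix $\beta>0$. For $n\ge 1$ let $(\theta_1,\dots,\theta_n)$ be random with joint probability density $$\frac1{Z_n}\prod_{1\le j<k\le n}\big|e^{i\theta_j}+e^{i\theta_k}\big|^{\beta},\qquad \theta_1,\dots,\theta_n\in(-\pi,\pi],$$ with respect to Lebesgue measure, where $Z_n$ is the normalization constant, and for $f:\mathbb R\to\mathbb R$ put $$I(f)=\int_{-\pi}^{\pi}\!\cdots\!\int_{-\pi}^{\pi}\ \prod_{1\le j<k\le n}\big|e^{i\theta_j}+e^{i\theta_k}\big|^{\beta}\ \prod_{j=1}^n e^{f(\theta_j)}\,d\theta_j .$$ Let $0<q\le 1$ and let $g:\mathbb R\to\mathbb R$ be $2\pi$-periodic and Hölder continuous with exponent $q$ (i.e. $|g(x)-g(y)|\le L|x-y|^q$ for all $x,y\in\mathbb R$ and some constant $L$). Then for every $n\ge1$ and $t\in\mathbb R$, $$\mathbb E\Big[e^{\frac tn\sum_{j=1}^n g(\theta_j)}\Big]=\frac{I(\frac tn g)}{I(0)},$$ and for every fixed $0<\zeta<\frac q2$, as $n\to\infty$, $$\mathbb E\Big[e^{\frac tn\sum_{j=1}^n g(\theta_j)}\Big]=\frac1{2\pi}\int_{-\pi}^{\pi}e^{t\,g(\theta)}\,d\theta+O(n^{-\zeta}),$$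 uniformly for $t$ in compact subsets of $\mathbb R$. -/

import Mathlib

open MeasureTheory Filter
open scoped NNReal

noncomputable section

/-- The cube `(-π, π]^n` in which the angles `θ₁, …, θₙ` live. -/
def angleCube (n : ℕ) : Set (Fin n → ℝ) :=
  Set.univ.pi fun _ => Set.Ioc (-Real.pi) Real.pi

/-- The unnormalized density `∏_{j<k} |e^{iθ_j} + e^{iθ_k}|^β`. -/
def antipodalWeight (β : ℝ) {n : ℕ} (θ : Fin n → ℝ) : ℝ :=
  ∏ j : Fin n, ∏ k ∈ Finset.Ioi j,
    ‖Complex.exp (Complex.I * (θ j : ℂ)) + Complex.exp (Complex.I * (θ k : ℂ))‖ ^ β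

/-- The normalization constant `Z_n`. -/
def antipodalZ (β : ℝ) (n : ℕ) : ℝ :=
  ∫ θ in angleCube n, antipodalWeight β θ

/-- The joint law of `(θ₁, …, θₙ)`: density `Z_n⁻¹ ∏_{j<k} |e^{iθ_j} + e^{iθ_k}|^β` with
respect to Lebesgue measure on `(-π, π]^n`. -/
def antipodalLaw (β : ℝ) (n : ℕ) : Measure (Fin n → ℝ) :=
  (volume.restrict (angleCube n)).withDensity
    fun θ => ENNReal.ofReal (antipodalWeight β θ / antipodalZ β n)

/-- The `n`-fold integral
`I(f) = ∫ ⋯ ∫ ∏_{j<k} |e^{iθ_j} + e^{iθ_k}|^β ∏_j e^{f(θ_j)} dθ_j` over `(-π, π]^n`. -/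
def antipodalI (β : ℝ) (n : ℕ) (f : ℝ → ℝ) : ℝ :=
  ∫ θ in angleCube n, antipodalWeight β θ * ∏ j : Fin n, Real.exp (f (θ j))

end

/-! Each factor equals `(2 |cos ((θ j - θ k) / 2)|) ^ β`, so the weight is largest when all angles
coincide and it attracts them to one another. It is at most its maximum times `exp (-β S / 2)`, with
`S` the `sineEnergy`, and it keeps a fixed fraction of the maximum on a cube of side `1 / n`. That
cube costs only `n log n` in the exponent, so a Gibbs variational argument
(`integral_weight_mul_sineEnergy_le`) gives mean energy `O(n log n)`, although `S` sums over about
`n ^ 2 / 2` pairs.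

A typical configuration is therefore a single cluster, and a periodic Hölder `g` is nearly constant
on it. Hence the exponential of the mean of `t * g` is close to the mean of the exponentials
(`abs_exp_mean_sub_mean_exp_le`). The expectation of the latter is exactly the circle average, since
rotation invariance makes each angle uniform (`integral_weight_mul_eq`). Optimizing a scale `ε`
close to `1 / n` yields the rate. -/

/-! ### Gaussian bounds for the pair interaction -/

lemma norm_exp_I_add_exp_I (a b : ℝ) :
    ‖Complex.exp (Complex.I * (a : ℂ)) + Complex.exp (Complex.I * (b : ℂ))‖ =
      2 * |Real.cos ((a - b) / 2)| := by
  have h : Complex.exp (Complex.I * (a : ℂ)) + Complex.exp (Complex.I * (b : ℂ)) =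
      Complex.exp (((a + b) / 2 : ℝ) * Complex.I) * (2 * ((Real.cos ((a - b) / 2) : ℝ) : ℂ)) := by
    push_cast
    rw [Complex.cos]
    rw [mul_div_cancel₀ _ (two_ne_zero), mul_add, ← Complex.exp_add, ← Complex.exp_add]
    congr 2 <;> ring
  rw [h, norm_mul, Complex.norm_exp_ofReal_mul_I, norm_mul, Complex.norm_real]
  simp

/-- After squaring, this is `1 - s ≤ exp (-s)` at `s = sin² x`. -/
lemma abs_cos_le_exp_neg_sin_sq (x : ℝ) : |Real.cos x| ≤ Real.exp (-(Real.sin x ^ 2 / 2)) := by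
  refine abs_le_of_sq_le_sq ?_ (Real.exp_pos _).le
  rw [← Real.exp_nat_mul, Real.cos_sq']
  have := Real.add_one_le_exp (-(Real.sin x ^ 2))
  have h2 : ((2 : ℕ) : ℝ) * -(Real.sin x ^ 2 / 2) = -(Real.sin x ^ 2) := by push_cast; ring
  rw [h2]
  linarith

/-- Follows from `(1 + x²)(1 - x² / 2) ≥ 1`, valid for `x² ≤ 1`. -/
lemma exp_neg_sq_le_abs_cos {x : ℝ} (hx : |x| ≤ 1) : Real.exp (-(x ^ 2)) ≤ |Real.cos x| := by
  have h1 : x ^ 2 ≤ 1 := by rw [← sq_abs]; exact pow_le_one₀ (abs_nonneg x) hx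
  have h2 := Real.one_sub_sq_div_two_le_cos (x := x)
  have h3 := Real.add_one_le_exp (x ^ 2)
  refine le_trans ?_ (h2.trans (le_abs_self _))
  rw [Real.exp_neg, inv_le_iff_one_le_mul₀' (Real.exp_pos _)]
  nlinarith [sq_nonneg x]

/-- The pair interaction is dominated by a Gaussian in the sine of the half difference. -/
lemma rpow_norm_exp_add_le {β : ℝ} (hβ : 0 < β) (a b : ℝ) :
    ‖Complex.exp (Complex.I * (a : ℂ)) + Complex.exp (Complex.I * (b : ℂ))‖ ^ β ≤
      2 ^ β * Real.exp (-(β / 2 * Real.sin ((a - b) / 2) ^ 2)) := by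
  rw [norm_exp_I_add_exp_I, Real.mul_rpow zero_le_two (abs_nonneg _)]
  gcongr
  calc |Real.cos ((a - b) / 2)| ^ β ≤ Real.exp (-(Real.sin ((a - b) / 2) ^ 2 / 2)) ^ β :=
        Real.rpow_le_rpow (abs_nonneg _) (abs_cos_le_exp_neg_sin_sq _) hβ.le
    _ = _ := by rw [← Real.exp_mul]; congr 1; ring

lemma le_rpow_norm_exp_add {β δ : ℝ} (hβ : 0 < β) (hδ : δ ≤ 1) {a b : ℝ} (hab : |a - b| ≤ δ) :
    2 ^ β * Real.exp (-(β * δ ^ 2)) ≤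
      ‖Complex.exp (Complex.I * (a : ℂ)) + Complex.exp (Complex.I * (b : ℂ))‖ ^ β := by
  rw [norm_exp_I_add_exp_I, Real.mul_rpow zero_le_two (abs_nonneg _)]
  gcongr
  have h0 : |(a - b) / 2| ≤ δ := by
    rw [abs_div, abs_two]; linarith [abs_nonneg (a - b)]
  calc Real.exp (-(β * δ ^ 2)) = Real.exp (-(δ ^ 2)) ^ β := by
        rw [← Real.exp_mul]; congr 1; ring
    _ ≤ Real.exp (-(((a - b) / 2) ^ 2)) ^ β := by
        have : ((a - b) / 2) ^ 2 ≤ δ ^ 2 := sq_le_sq' (abs_le.1 h0).1 (abs_le.1 h0).2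
        gcongr
    _ ≤ _ := Real.rpow_le_rpow (Real.exp_pos _).le (exp_neg_sq_le_abs_cos (h0.trans hδ)) hβ.le

/-! ### Energy and bounds on the full weight -/

/-- The energy `∑_{j<k} sin² ((θ_j - θ_k) / 2)` measuring the spread of a configuration. -/
noncomputable def sineEnergy {n : ℕ} (θ : Fin n → ℝ) : ℝ :=
  ∑ j : Fin n, ∑ k ∈ Finset.Ioi j, Real.sin ((θ j - θ k) / 2) ^ 2

/-- The maximal value `2 ^ (β n (n - 1) / 2)` of the weight. -/
noncomputable def maxWeight (β : ℝ) (n : ℕ) : ℝ :=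
  ∏ j : Fin n, ∏ _k ∈ Finset.Ioi j, (2 : ℝ) ^ β

lemma maxWeight_pos (β : ℝ) (n : ℕ) : 0 < maxWeight β n :=
  Finset.prod_pos fun _ _ => Finset.prod_pos fun _ _ => by positivity

lemma antipodalWeight_nonneg (β : ℝ) {n : ℕ} (θ : Fin n → ℝ) : 0 ≤ antipodalWeight β θ :=
  Finset.prod_nonneg fun _ _ => Finset.prod_nonneg fun _ _ => by positivity

lemma continuous_sineEnergy (n : ℕ) : Continuous (sineEnergy (n := n)) := by
  unfold sineEnergy
  fun_prop

lemma continuous_antipodalWeight {β : ℝ} (hβ : 0 < β) (n : ℕ) :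
    Continuous (antipodalWeight β (n := n)) := by
  unfold antipodalWeight
  refine continuous_finsetProd _ fun j _ => continuous_finsetProd _ fun k _ => ?_
  refine Continuous.rpow_const ?_ fun _ => Or.inr hβ.le
  fun_prop

lemma antipodalWeight_le_exp {β : ℝ} (hβ : 0 < β) {n : ℕ} (θ : Fin n → ℝ) :
    antipodalWeight β θ ≤ maxWeight β n * Real.exp (-(β / 2 * sineEnergy θ)) := by
  have : maxWeight β n * Real.exp (-(β / 2 * sineEnergy θ)) =
      ∏ j : Fin n, ∏ k ∈ Finset.Ioi j,
        (2 ^ β * Real.exp (-(β / 2 * Real.sin ((θ j - θ k) / 2) ^ 2))) := by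
    simp_rw [maxWeight, sineEnergy, Finset.mul_sum, ← Finset.sum_neg_distrib, Real.exp_sum,
      Finset.prod_mul_distrib]
  rw [this]
  refine Finset.prod_le_prod (fun _ _ => Finset.prod_nonneg fun _ _ => by positivity) fun j _ => ?_
  exact Finset.prod_le_prod (fun _ _ => by positivity) fun k _ => rpow_norm_exp_add_le hβ _ _

/-- Fewer than `n ^ 2` pairs each lose at most `β / n ^ 2` in the exponent, so the total loss does
not depend on `n`. -/
lemma le_antipodalWeight {β : ℝ} (hβ : 0 < β) {n : ℕ} (hn : 1 ≤ n) {θ : Fin n → ℝ}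
    (hθ : ∀ j k, |θ j - θ k| ≤ 1 / n) :
    maxWeight β n * Real.exp (-β) ≤ antipodalWeight β θ := by
  have hn' : (1 : ℝ) ≤ n := by exact_mod_cast hn
  have hle : (1 : ℝ) / n ≤ 1 := (div_le_one (by linarith)).2 hn'
  have h1 : (∑ j : Fin n, ∑ _k ∈ Finset.Ioi j, β * (1 / (n : ℝ)) ^ 2) ≤ β := by
    calc _ ≤ ∑ _j : Fin n, ∑ _k : Fin n, β * (1 / (n : ℝ)) ^ 2 :=
          Finset.sum_le_sum fun j _ => Finset.sum_le_sum_of_subset_of_nonneg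
            (Finset.subset_univ _) fun _ _ _ => by positivity
      _ = β := by simp; field_simp
  have h2 : maxWeight β n *
      Real.exp (-(∑ j : Fin n, ∑ _k ∈ Finset.Ioi j, β * (1 / (n : ℝ)) ^ 2)) =
      ∏ j : Fin n, ∏ _k ∈ Finset.Ioi j, (2 ^ β * Real.exp (-(β * (1 / (n : ℝ)) ^ 2))) := by
    simp_rw [maxWeight, ← Finset.sum_neg_distrib, Real.exp_sum, Finset.prod_mul_distrib]
  calc maxWeight β n * Real.exp (-β) ≤ maxWeight β n *
      Real.exp (-(∑ j : Fin n, ∑ _k ∈ Finset.Ioi j, β * (1 / (n : ℝ)) ^ 2)) := by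
        have := (maxWeight_pos β n).le
        gcongr
    _ ≤ _ := by
      rw [h2]
      refine Finset.prod_le_prod (fun _ _ => Finset.prod_nonneg fun _ _ => by positivity)
        fun j _ => ?_
      exact Finset.prod_le_prod (fun _ _ => by positivity)
        fun k _ => le_rpow_norm_exp_add hβ hle (hθ j k)

lemma sum_sum_sin_sq {n : ℕ} (θ : Fin n → ℝ) :
    ∑ j : Fin n, ∑ k : Fin n, Real.sin ((θ j - θ k) / 2) ^ 2 = 2 * sineEnergy θ := by
  have hsymm : ∀ j k, Real.sin ((θ j - θ k) / 2) ^ 2 = Real.sin ((θ k - θ j) / 2) ^ 2 := by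
    intro j k
    rw [← neg_sub (θ k), neg_div, Real.sin_neg, neg_sq]
  have hsplit : ∀ j : Fin n, ∑ k : Fin n, Real.sin ((θ j - θ k) / 2) ^ 2 =
      (∑ k ∈ Finset.Ioi j, Real.sin ((θ j - θ k) / 2) ^ 2) +
        ∑ k ∈ Finset.Iio j, Real.sin ((θ j - θ k) / 2) ^ 2 := by
    intro j
    rw [← Finset.sum_union]
    · symm
      refine Finset.sum_subset (Finset.subset_univ _) fun k _ hk => ?_
      have : k = j := by
        simp only [Finset.mem_union, Finset.mem_Ioi, Finset.mem_Iio, not_or, not_lt] at hk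
        exact le_antisymm hk.1 hk.2
      simp [this]
    · exact Finset.disjoint_left.2 fun k h1 h2 =>
        lt_asymm (Finset.mem_Ioi.1 h1) (Finset.mem_Iio.1 h2)
  simp_rw [hsplit, Finset.sum_add_distrib]
  rw [two_mul, sineEnergy]
  congr 1
  rw [Finset.sum_comm' (t' := Finset.univ) (s' := fun k => Finset.Ioi k) (by simp)]
  exact Finset.sum_congr rfl fun k _ => Finset.sum_congr rfl fun j _ => hsymm j k

/-! ### Periodic Hölder functions and the chordal distance -/

lemma exists_int_abs_add_le (x : ℝ) : ∃ m : ℤ, |x + m * (2 * Real.pi)| ≤ Real.pi := by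
  refine ⟨-round (x / (2 * Real.pi)), ?_⟩
  have h := abs_sub_round (x / (2 * Real.pi))
  have hp := Real.pi_pos
  have : x + ((-round (x / (2 * Real.pi)) : ℤ) : ℝ) * (2 * Real.pi) =
      (x / (2 * Real.pi) - round (x / (2 * Real.pi))) * (2 * Real.pi) := by
    push_cast; field_simp; ring
  rw [this, abs_mul, abs_of_pos (by positivity : (0 : ℝ) < 2 * Real.pi)]
  nlinarith

/-- A periodic Hölder function is Hölder with respect to the chordal distance. -/
lemma abs_sub_le_sin_of_holder {g : ℝ → ℝ} (hper : Function.Periodic g (2 * Real.pi))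
    {L q : ℝ≥0} (hg : HolderWith L q g) (x y : ℝ) :
    |g x - g y| ≤ L * (Real.pi * |Real.sin ((x - y) / 2)|) ^ (q : ℝ) := by
  obtain ⟨m, hm⟩ := exists_int_abs_add_le (x - y)
  have h1 : g (x + m * (2 * Real.pi)) = g x := hper.int_mul m x
  have h2 := hg.dist_le (x + m * (2 * Real.pi)) y
  rw [h1, Real.dist_eq, Real.dist_eq] at h2
  refine h2.trans ?_
  have h3 : |x + m * (2 * Real.pi) - y| ≤ Real.pi * |Real.sin ((x - y) / 2)| := by
    set d := x - y + m * (2 * Real.pi) with hd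
    have e1 : x + m * (2 * Real.pi) - y = d := by rw [hd]; ring
    have e2 : |Real.sin ((x - y) / 2)| = |Real.sin (d / 2)| := by
      have : d / 2 = (x - y) / 2 + m * Real.pi := by rw [hd]; ring
      rw [this, Real.sin_add_int_mul_pi, abs_mul]
      rcases Int.even_or_odd m with h | h <;> simp [h.neg_one_zpow]
    rw [e1, e2]
    -- Jordan's inequality needs `|d / 2| ≤ π / 2`, which the shift by `m` periods provides.
    have h4 := Real.mul_abs_le_abs_sin (x := d / 2) (by rw [abs_div, abs_two]; linarith)
    rw [abs_div, abs_two] at h4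
    have hp := Real.pi_pos
    calc |d| = Real.pi * (2 / Real.pi * (|d| / 2)) := by field_simp
      _ ≤ _ := by gcongr
  gcongr

/-! ### Partition function and mean energy -/

lemma volume_real_angleCube (n : ℕ) : volume.real (angleCube n) = (2 * Real.pi) ^ n := by
  have hp := Real.pi_pos
  rw [Measure.real, angleCube, Real.volume_pi_Ioc]
  simp only [Finset.prod_const, Finset.card_univ, Fintype.card_fin, ENNReal.toReal_pow]
  rw [ENNReal.toReal_ofReal (by linarith)]
  ring

lemma integrableOn_angleCube {n : ℕ} {f : (Fin n → ℝ) → ℝ} (hf : Continuous f) :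
    IntegrableOn f (angleCube n) := by
  refine (hf.continuousOn.integrableOn_compact (K := Set.univ.pi fun _ =>
    Set.Icc (-Real.pi) Real.pi) (isCompact_univ_pi fun _ => isCompact_Icc)).mono_set ?_
  exact Set.pi_mono fun _ _ => Set.Ioc_subset_Icc_self

instance (n : ℕ) : IsFiniteMeasure (volume.restrict (angleCube n)) :=
  isFiniteMeasure_restrict.2 (by
    rw [angleCube, Real.volume_pi_Ioc]
    exact ENNReal.prod_ne_top fun _ _ => ENNReal.ofReal_ne_top)

lemma le_antipodalZ {β : ℝ} (hβ : 0 < β) {n : ℕ} (hn : 1 ≤ n) :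
    maxWeight β n * Real.exp (-β) * (1 / (n : ℝ)) ^ n ≤ antipodalZ β n := by
  have hn' : (1 : ℝ) ≤ n := by exact_mod_cast hn
  have hle : (1 : ℝ) / n ≤ 1 := (div_le_one (by linarith)).2 hn'
  have hpos : (0 : ℝ) < 1 / n := by positivity
  set B : Set (Fin n → ℝ) := Set.univ.pi fun _ => Set.Ioc 0 (1 / (n : ℝ)) with hB
  have hBm : MeasurableSet B := MeasurableSet.univ_pi fun _ => measurableSet_Ioc
  have hsub : B ⊆ angleCube n := Set.pi_mono fun _ _ =>
    Set.Ioc_subset_Ioc (by linarith [Real.pi_pos]) (by linarith [Real.pi_gt_three])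
  have hint := integrableOn_angleCube (continuous_antipodalWeight hβ n)
  have hvol : volume.real B = (1 / (n : ℝ)) ^ n := by
    rw [Measure.real, hB, Real.volume_pi_Ioc]
    simp only [Finset.prod_const, Finset.card_univ, Fintype.card_fin, ENNReal.toReal_pow, sub_zero]
    rw [ENNReal.toReal_ofReal hpos.le]
  have hBtop : volume B ≠ ⊤ := by
    rw [hB, Real.volume_pi_Ioc]
    exact ENNReal.prod_ne_top fun _ _ => ENNReal.ofReal_ne_top
  calc maxWeight β n * Real.exp (-β) * (1 / (n : ℝ)) ^ n
      = ∫ _θ in B, maxWeight β n * Real.exp (-β) := by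
        rw [setIntegral_const, hvol, smul_eq_mul]; ring
    _ ≤ ∫ θ in B, antipodalWeight β θ := by
        refine setIntegral_mono_on (integrableOn_const hBtop) (hint.mono_set hsub) hBm fun θ hθ => ?_
        refine le_antipodalWeight hβ hn fun j k => ?_
        have hj := hθ j trivial
        have hk := hθ k trivial
        rw [abs_le]
        constructor <;> linarith [hj.1, hj.2, hk.1, hk.2]
    _ ≤ antipodalZ β n :=
        setIntegral_mono_set hint (ae_of_all _ fun θ => antipodalWeight_nonneg β θ)
          hsub.eventuallyLE

lemma antipodalZ_pos {β : ℝ} (hβ : 0 < β) {n : ℕ} (hn : 1 ≤ n) : 0 < antipodalZ β n := by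
  refine lt_of_lt_of_le ?_ (le_antipodalZ hβ hn)
  have := maxWeight_pos β n
  have : (0 : ℝ) < n := by exact_mod_cast hn
  positivity

/-- Gibbs variational bound on the mean energy. -/
lemma integral_weight_mul_sineEnergy_le {β : ℝ} (hβ : 0 < β) {n : ℕ} (hn : 1 ≤ n) :
    β / 2 * ∫ θ in angleCube n, antipodalWeight β θ * sineEnergy θ ≤
      (β + n * Real.log (2 * Real.pi * n) + 1) * antipodalZ β n := by
  have hn' : (0 : ℝ) < n := by exact_mod_cast hn
  have hp := Real.pi_pos
  -- Chosen so that `exp (-h) * (2π) ^ n = exp (-β) * n ^ (-n)`: the constant remainder in `hpt`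
  -- then integrates to the lower bound for `antipodalZ`.
  set h := β + n * Real.log (2 * Real.pi * n) with hh
  have hw := continuous_antipodalWeight hβ n
  have hpt : ∀ θ : Fin n → ℝ, β / 2 * (antipodalWeight β θ * sineEnergy θ) ≤
      h * antipodalWeight β θ + maxWeight β n * Real.exp (-h) := by
    intro θ
    -- The exponential on the right is cancelled by the Gaussian decay of the weight.
    have h1 := Real.add_one_le_exp (β / 2 * sineEnergy θ - h)
    have h2 := antipodalWeight_le_exp hβ θ
    have h3 : Real.exp (β / 2 * sineEnergy θ - h) * antipodalWeight β θ ≤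
        maxWeight β n * Real.exp (-h) := by
      calc _ ≤ Real.exp (β / 2 * sineEnergy θ - h) *
            (maxWeight β n * Real.exp (-(β / 2 * sineEnergy θ))) := by gcongr
        _ = maxWeight β n * (Real.exp (β / 2 * sineEnergy θ - h) *
            Real.exp (-(β / 2 * sineEnergy θ))) := by ring
        _ = _ := by rw [← Real.exp_add]; congr 2; ring
    have h4 := mul_le_mul_of_nonneg_right h1 (antipodalWeight_nonneg β θ)
    nlinarith [antipodalWeight_nonneg β θ]
  have hexp : maxWeight β n * Real.exp (-h) * (2 * Real.pi) ^ n =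
      maxWeight β n * Real.exp (-β) * (1 / (n : ℝ)) ^ n := by
    have : Real.exp (n * Real.log (2 * Real.pi * n)) = (2 * Real.pi * n) ^ n := by
      rw [Real.exp_nat_mul, Real.exp_log (by positivity)]
    rw [hh, neg_add, Real.exp_add, Real.exp_neg (_ * _), this, mul_pow, one_div, inv_pow]
    field_simp
  rw [← integral_const_mul]
  calc ∫ θ in angleCube n, β / 2 * (antipodalWeight β θ * sineEnergy θ)
      ≤ ∫ θ in angleCube n, (h * antipodalWeight β θ + maxWeight β n * Real.exp (-h)) := by
        refine integral_mono ?_ ?_ hpt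
        · exact integrableOn_angleCube
            (continuous_const.mul (hw.mul (continuous_sineEnergy n)))
        · exact integrableOn_angleCube ((continuous_const.mul hw).add continuous_const)
    _ = h * antipodalZ β n + maxWeight β n * Real.exp (-h) * (2 * Real.pi) ^ n := by
        have hi : Integrable (fun θ => h * antipodalWeight β θ) (volume.restrict (angleCube n)) :=
          integrableOn_angleCube (continuous_const.mul hw)
        rw [integral_add hi (integrable_const _), integral_const_mul, integral_const, measureReal_restrict_apply_univ,
          volume_real_angleCube, antipodalZ, smul_eq_mul]
        ring
    _ ≤ _ := by
        rw [hexp]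
        linarith [le_antipodalZ hβ hn]

/-! ### Rotation invariance and uniform marginals -/

/-- Rotations of the circle, read in the fundamental domain `(-π, π]`, preserve Lebesgue measure. -/
lemma exists_measurePreserving_rotation (φ : ℝ) : ∃ τ : ℝ → ℝ,
    MeasurePreserving τ (volume.restrict (Set.Ioc (-Real.pi) Real.pi))
      (volume.restrict (Set.Ioc (-Real.pi) Real.pi)) ∧
    ∀ x, ∃ m : ℤ, τ x = x + φ + m * (2 * Real.pi) := by
  have hp := Real.pi_pos
  have : Fact (0 < 2 * Real.pi) := ⟨by positivity⟩
  have hI : Set.Ioc (-Real.pi) (-Real.pi + 2 * Real.pi) = Set.Ioc (-Real.pi) Real.pi := by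
    congr 1; ring
  have h1 := AddCircle.measurePreserving_mk (2 * Real.pi) (-Real.pi)
  have h2 := measurePreserving_add_right (volume : Measure (AddCircle (2 * Real.pi)))
    (φ : AddCircle (2 * Real.pi))
  have h3 := AddCircle.measurePreserving_equivIoc (2 * Real.pi) (a := -Real.pi)
  have h4 := measurePreserving_subtype_coe (μa := (volume : Measure ℝ))
    (measurableSet_Ioc (a := -Real.pi) (b := -Real.pi + 2 * Real.pi))
  have h5 := h4.comp (h3.comp (h2.comp h1))
  rw [← hI]
  refine ⟨_, h5, fun x => ?_⟩
  have h6 : ((AddCircle.equivIoc (2 * Real.pi) (-Real.pi)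
      ((x : AddCircle (2 * Real.pi)) + φ) : ℝ) : AddCircle (2 * Real.pi)) = ((x + φ : ℝ) :) := by
    rw [AddCircle.coe_add]
    exact (AddCircle.equivIoc (2 * Real.pi) (-Real.pi)).symm_apply_apply _
  rw [← sub_eq_zero, ← AddCircle.coe_sub, AddCircle.coe_eq_zero_iff] at h6
  obtain ⟨m, hm⟩ := h6
  refine ⟨m, ?_⟩
  rw [zsmul_eq_mul] at hm
  simp only [Function.comp_apply]
  linarith

lemma exp_I_add_int_mul (x : ℝ) (m : ℤ) :
    Complex.exp (Complex.I * ((x + m * (2 * Real.pi) : ℝ) : ℂ)) =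
      Complex.exp (Complex.I * (x : ℂ)) := by
  rw [← Complex.exp_periodic.int_mul m (Complex.I * (x : ℂ))]
  congr 1
  push_cast
  ring

/-- The shifts `m j` vary with `j` because each rotated angle wraps back into `(-π, π]` separately.
-/
lemma antipodalWeight_rotate (β : ℝ) {n : ℕ} (θ : Fin n → ℝ) (φ : ℝ) (m : Fin n → ℤ) :
    antipodalWeight β (fun j => θ j + φ + m j * (2 * Real.pi)) = antipodalWeight β θ := by
  unfold antipodalWeight
  refine Finset.prod_congr rfl fun j _ => Finset.prod_congr rfl fun k _ => ?_
  rw [exp_I_add_int_mul, exp_I_add_int_mul, norm_exp_I_add_exp_I, norm_exp_I_add_exp_I]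
  congr 5
  ring

lemma integral_weight_mul_add {β : ℝ} (hβ : 0 < β) {n : ℕ} {f : ℝ → ℝ} (hf : Continuous f)
    (hper : Function.Periodic f (2 * Real.pi)) (k : Fin n) (φ : ℝ) :
    ∫ θ in angleCube n, antipodalWeight β θ * f (θ k + φ) =
      ∫ θ in angleCube n, antipodalWeight β θ * f (θ k) := by
  obtain ⟨τ, hτ, hm⟩ := exists_measurePreserving_rotation φ
  choose m hm using hm
  have hpi := measurePreserving_pi (fun _ : Fin n => volume.restrict (Set.Ioc (-Real.pi) Real.pi))
    (fun _ => volume.restrict (Set.Ioc (-Real.pi) Real.pi)) (fun _ => hτ)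
  rw [← Measure.restrict_pi_pi, ← volume_pi] at hpi
  change MeasurePreserving _ (volume.restrict (angleCube n)) (volume.restrict (angleCube n)) at hpi
  have hcont : Continuous fun θ : Fin n → ℝ => antipodalWeight β θ * f (θ k) :=
    (continuous_antipodalWeight hβ n).mul (hf.comp (continuous_apply k))
  have h1 := integral_map (μ := volume.restrict (angleCube n)) (f := fun θ : Fin n → ℝ => antipodalWeight β θ * f (θ k))
    hpi.measurable.aemeasurable (hcont.aestronglyMeasurable)
  rw [hpi.map_eq] at h1
  rw [h1]
  refine integral_congr_ae (ae_of_all _ fun θ => ?_)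
  simp only [hm]
  rw [antipodalWeight_rotate β θ φ (fun j => m (θ j)), hper.int_mul]

/-- Each single angle is uniformly distributed. -/
lemma integral_weight_mul_eq {β : ℝ} (hβ : 0 < β) {n : ℕ} {f : ℝ → ℝ} (hf : Continuous f)
    (hper : Function.Periodic f (2 * Real.pi)) (k : Fin n) :
    ∫ θ in angleCube n, antipodalWeight β θ * f (θ k) =
      antipodalZ β n * (1 / (2 * Real.pi) * ∫ x in (-Real.pi)..Real.pi, f x) := by
  have hp := Real.pi_pos
  have hpp : -Real.pi ≤ Real.pi := by linarith
  have hw := continuous_antipodalWeight hβ n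
  -- Average over all rotations `φ`: the left side is constant in `φ`, while on the right the inner
  -- integral covers a full period and forgets `θ k`.
  have hswap : ∫ φ in (-Real.pi)..Real.pi, ∫ θ in angleCube n,
      antipodalWeight β θ * f (θ k + φ) =
      ∫ θ in angleCube n, ∫ φ in (-Real.pi)..Real.pi, antipodalWeight β θ * f (θ k + φ) := by
    rw [intervalIntegral.integral_of_le hpp]
    simp_rw [intervalIntegral.integral_of_le hpp]
    refine integral_integral_swap ?_
    have hc : Continuous fun p : ℝ × (Fin n → ℝ) => antipodalWeight β p.2 * f (p.2 k + p.1) := by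
      fun_prop
    rw [Measure.prod_restrict, ← Measure.volume_eq_prod]
    refine (hc.continuousOn.integrableOn_compact (K := Set.Icc (-Real.pi) Real.pi ×ˢ
      Set.univ.pi fun _ => Set.Icc (-Real.pi) Real.pi)
      (isCompact_Icc.prod (isCompact_univ_pi fun _ => isCompact_Icc))).mono_set ?_
    exact Set.prod_mono Set.Ioc_subset_Icc_self
      (Set.pi_mono fun _ _ => Set.Ioc_subset_Icc_self)
  have hinner : ∀ a : ℝ, ∫ φ in (-Real.pi)..Real.pi, f (a + φ) =
      ∫ x in (-Real.pi)..Real.pi, f x := by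
    intro a
    rw [intervalIntegral.integral_comp_add_left]
    have := hper.intervalIntegral_add_eq (a + -Real.pi) (-Real.pi)
    rw [show a + -Real.pi + 2 * Real.pi = a + Real.pi by ring,
      show -Real.pi + 2 * Real.pi = Real.pi by ring] at this
    exact this
  simp_rw [integral_weight_mul_add hβ hf hper, intervalIntegral.integral_const_mul, hinner] at hswap
  rw [intervalIntegral.integral_const, integral_mul_const, smul_eq_mul] at hswap
  rw [antipodalZ]
  field_simp
  linarith

/-! ### Exponential of the mean against mean of the exponentials -/

lemma abs_exp_sub_exp_le {a b B : ℝ} (ha : a ≤ B) (hb : b ≤ B) :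
    |Real.exp a - Real.exp b| ≤ Real.exp B * |a - b| := by
  wlog h : b ≤ a generalizing a b
  · rw [abs_sub_comm, abs_sub_comm a]
    exact this hb ha (le_of_not_ge h)
  rw [abs_of_nonneg (sub_nonneg.2 (Real.exp_le_exp.2 h)), abs_of_nonneg (sub_nonneg.2 h)]
  have h1 := Real.add_one_le_exp (b - a)
  rw [Real.exp_sub, le_div_iff₀ (Real.exp_pos a)] at h1
  have h2 : Real.exp a * (a - b) ≤ Real.exp B * (a - b) :=
    mul_le_mul_of_nonneg_right (Real.exp_le_exp.2 ha) (sub_nonneg.2 h)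
  linarith

/-- With `v = u / ε`, `v ^ p ≤ max 1 v ≤ 1 + v`. This makes the Hölder bound affine in the energy,
so that controlling the mean energy suffices. -/
lemma rpow_le_mul_one_add_div {u ε p : ℝ} (hu : 0 ≤ u) (hε : 0 < ε) (hp0 : 0 ≤ p) (hp1 : p ≤ 1) :
    u ^ p ≤ ε ^ p * (1 + u / ε) := by
  have h : u ^ p = ε ^ p * (u / ε) ^ p := by
    rw [← Real.mul_rpow hε.le (by positivity), mul_div_cancel₀ _ hε.ne']
  rw [h]
  gcongr
  have hv : 0 ≤ u / ε := by positivity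
  rcases le_total (u / ε) 1 with h1 | h1
  · linarith [Real.rpow_le_one hv h1 hp0]
  · have := Real.rpow_le_rpow_of_exponent_le h1 hp1
    rw [Real.rpow_one] at this
    linarith

lemma abs_sub_le_energy_of_holder {g : ℝ → ℝ} (hper : Function.Periodic g (2 * Real.pi))
    {L q : ℝ≥0} (hq1 : q ≤ 1) (hg : HolderWith L q g) {ε : ℝ} (hε : 0 < ε) (x y : ℝ) :
    |g x - g y| ≤ L * Real.pi ^ (q : ℝ) * ε ^ ((q : ℝ) / 2) *
      (1 + Real.sin ((x - y) / 2) ^ 2 / ε) := by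
  have hq1' : (q : ℝ) ≤ 1 := by exact_mod_cast hq1
  have hq0' : (0 : ℝ) ≤ q := q.2
  refine (abs_sub_le_sin_of_holder hper hg x y).trans ?_
  have h := rpow_le_mul_one_add_div (sq_nonneg (Real.sin ((x - y) / 2))) hε
    (p := (q : ℝ) / 2) (by positivity) (by linarith)
  have h2 : (Real.sin ((x - y) / 2) ^ 2) ^ ((q : ℝ) / 2) = |Real.sin ((x - y) / 2)| ^ (q : ℝ) := by
    rw [← sq_abs, ← Real.rpow_natCast, ← Real.rpow_mul (abs_nonneg _)]
    congr 1
    push_cast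
    ring
  rw [h2] at h
  rw [Real.mul_rpow Real.pi_pos.le (abs_nonneg _)]
  calc (L : ℝ) * (Real.pi ^ (q : ℝ) * |Real.sin ((x - y) / 2)| ^ (q : ℝ))
      ≤ L * (Real.pi ^ (q : ℝ) * (ε ^ ((q : ℝ) / 2) * (1 + Real.sin ((x - y) / 2) ^ 2 / ε))) := by
        gcongr
    _ = _ := by ring

lemma exists_abs_le_of_holder {g : ℝ → ℝ} (hper : Function.Periodic g (2 * Real.pi))
    {L q : ℝ≥0} (hq1 : q ≤ 1) (hg : HolderWith L q g) : ∃ G, ∀ x, |g x| ≤ G := by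
  refine ⟨|g 0| + L * Real.pi ^ (q : ℝ) * 1 ^ ((q : ℝ) / 2) * (1 + 1 / 1), fun x => ?_⟩
  have h := abs_sub_le_energy_of_holder hper hq1 hg one_pos x 0
  have h1 : |g x| ≤ |g 0| + |g x - g 0| := by
    have := abs_add_le (g 0) (g x - g 0)
    rwa [add_sub_cancel] at this
  refine h1.trans (add_le_add le_rfl (h.trans ?_))
  have := Real.sin_sq_le_one ((x - 0) / 2)
  gcongr

/-- The exponential of the empirical mean is close to the empirical mean of the exponentials. -/
lemma abs_exp_mean_sub_mean_exp_le {g : ℝ → ℝ} (hper : Function.Periodic g (2 * Real.pi))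
    {L q : ℝ≥0} (hq1 : q ≤ 1) (hg : HolderWith L q g) {G T t ε : ℝ} (hG : ∀ x, |g x| ≤ G)
    (ht : |t| ≤ T) (hε : 0 < ε) {n : ℕ} (hn : 1 ≤ n) (θ : Fin n → ℝ) :
    |Real.exp (t / n * ∑ j, g (θ j)) - 1 / n * ∑ k, Real.exp (t * g (θ k))| ≤
      Real.exp (T * G) * T * (L * Real.pi ^ (q : ℝ) * ε ^ ((q : ℝ) / 2)) *
        (1 + 2 / ((n : ℝ) ^ 2 * ε) * sineEnergy θ) := by
  have hn' : (0 : ℝ) < n := by exact_mod_cast hn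
  have hT : 0 ≤ T := (abs_nonneg t).trans ht
  set A := (L : ℝ) * Real.pi ^ (q : ℝ) * ε ^ ((q : ℝ) / 2) with hA
  have hle : ∀ x, t * g x ≤ T * G := fun x => by
    refine (le_abs_self _).trans ?_
    rw [abs_mul]
    exact mul_le_mul ht (hG x) (abs_nonneg _) hT
  have hmean : t / n * ∑ j, g (θ j) ≤ T * G := by
    rw [div_mul_eq_mul_div, div_le_iff₀ hn', Finset.mul_sum]
    calc _ ≤ ∑ _j : Fin n, T * G := Finset.sum_le_sum fun j _ => hle _
      _ = _ := by simp; ring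
  have hk : ∀ k, |Real.exp (t / n * ∑ j, g (θ j)) - Real.exp (t * g (θ k))| ≤
      Real.exp (T * G) * (T * (1 / n * ∑ j, A * (1 + Real.sin ((θ j - θ k) / 2) ^ 2 / ε))) := by
    intro k
    refine (abs_exp_sub_exp_le hmean (hle _)).trans ?_
    gcongr
    have : t / n * ∑ j, g (θ j) - t * g (θ k) = t * (1 / n * ∑ j, (g (θ j) - g (θ k))) := by
      rw [Finset.sum_sub_distrib]
      simp
      field_simp
    rw [this, abs_mul, abs_mul, abs_of_pos (by positivity : 0 < 1 / (n : ℝ))]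
    gcongr
    exact (Finset.abs_sum_le_sum_abs _ _).trans
      (Finset.sum_le_sum fun j _ => abs_sub_le_energy_of_holder hper hq1 hg hε _ _)
  have hsplit : Real.exp (t / n * ∑ j, g (θ j)) - 1 / n * ∑ k, Real.exp (t * g (θ k)) =
      1 / n * ∑ k, (Real.exp (t / n * ∑ j, g (θ j)) - Real.exp (t * g (θ k))) := by
    rw [Finset.sum_sub_distrib]
    simp
    field_simp
  rw [hsplit, abs_mul, abs_of_pos (by positivity : 0 < 1 / (n : ℝ))]
  calc 1 / (n : ℝ) * |∑ k, (Real.exp (t / n * ∑ j, g (θ j)) - Real.exp (t * g (θ k)))|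
      ≤ 1 / n * ∑ k : Fin n, Real.exp (T * G) *
          (T * (1 / n * ∑ j, A * (1 + Real.sin ((θ j - θ k) / 2) ^ 2 / ε))) := by
        gcongr
        exact (Finset.abs_sum_le_sum_abs _ _).trans (Finset.sum_le_sum fun k _ => hk k)
    _ = _ := by
        simp_rw [← Finset.mul_sum, Finset.sum_add_distrib, ← Finset.sum_div]
        have hs := sum_sum_sin_sq θ
        rw [Finset.sum_comm] at hs
        rw [hs]
        simp
        field_simp

/-! ### Error estimate at an arbitrary scale `ε` -/

lemma integral_antipodalLaw {β : ℝ} (hβ : 0 < β) (n : ℕ) (f : (Fin n → ℝ) → ℝ) :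
    ∫ θ, f θ ∂(antipodalLaw β n) =
      (∫ θ in angleCube n, antipodalWeight β θ * f θ) / antipodalZ β n := by
  have hZ : 0 ≤ antipodalZ β n := integral_nonneg fun θ => antipodalWeight_nonneg β θ
  rw [antipodalLaw, integral_withDensity_eq_integral_toReal_smul
    ((continuous_antipodalWeight hβ n).measurable.div_const _).ennreal_ofReal
    (ae_of_all _ fun _ => ENNReal.ofReal_lt_top), ← integral_div]
  refine integral_congr_ae (ae_of_all _ fun θ => ?_)
  simp only [smul_eq_mul]
  rw [ENNReal.toReal_ofReal (div_nonneg (antipodalWeight_nonneg β θ) hZ)]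
  ring

lemma isProbabilityMeasure_antipodalLaw {β : ℝ} (hβ : 0 < β) {n : ℕ} (hn : 1 ≤ n) :
    IsProbabilityMeasure (antipodalLaw β n) := by
  have hZ := antipodalZ_pos hβ hn
  constructor
  rw [antipodalLaw, withDensity_apply _ MeasurableSet.univ, Measure.restrict_univ,
    ← ofReal_integral_eq_lintegral_ofReal
      (integrableOn_angleCube ((continuous_antipodalWeight hβ n).div_const _))
      (ae_of_all _ fun θ => div_nonneg (antipodalWeight_nonneg β θ) hZ.le), integral_div]
  change ENNReal.ofReal (antipodalZ β n / antipodalZ β n) = 1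
  rw [div_self hZ.ne', ENNReal.ofReal_one]

lemma abs_integral_exp_mean_sub_le {β : ℝ} (hβ : 0 < β) {g : ℝ → ℝ}
    (hper : Function.Periodic g (2 * Real.pi)) {L q : ℝ≥0} (hq0 : 0 < q) (hq1 : q ≤ 1)
    (hg : HolderWith L q g) {G T t ε : ℝ} (hG : ∀ x, |g x| ≤ G) (ht : |t| ≤ T) (hε : 0 < ε)
    {n : ℕ} (hn : 1 ≤ n) :
    |∫ θ : Fin n → ℝ, Real.exp (t / n * ∑ j, g (θ j)) ∂(antipodalLaw β n) -
        1 / (2 * Real.pi) * ∫ x in (-Real.pi)..Real.pi, Real.exp (t * g x)| ≤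
      Real.exp (T * G) * T * (L * Real.pi ^ (q : ℝ) * ε ^ ((q : ℝ) / 2)) *
        (1 + 4 / (β * ((n : ℝ) ^ 2 * ε)) * (β + n * Real.log (2 * Real.pi * n) + 1)) := by
  have hn' : (0 : ℝ) < n := by exact_mod_cast hn
  have hT : 0 ≤ T := (abs_nonneg t).trans ht
  have hgc : Continuous g := hg.continuous hq0
  have hZ := antipodalZ_pos hβ hn
  have hw := continuous_antipodalWeight hβ n
  have hS := continuous_sineEnergy n
  set m := 1 / (2 * Real.pi) * ∫ x in (-Real.pi)..Real.pi, Real.exp (t * g x) with hm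
  set K := Real.exp (T * G) * T * (L * Real.pi ^ (q : ℝ) * ε ^ ((q : ℝ) / 2)) with hK
  have hK0 : 0 ≤ K := by
    have := Real.pi_pos
    positivity
  have hmean : ∫ θ in angleCube n, antipodalWeight β θ * (1 / n * ∑ k, Real.exp (t * g (θ k))) =
      antipodalZ β n * m := by
    have h1 : ∀ k : Fin n, ∫ θ in angleCube n, antipodalWeight β θ * Real.exp (t * g (θ k)) =
        antipodalZ β n * m := fun k =>
      integral_weight_mul_eq (f := fun x => Real.exp (t * g x)) hβ (by fun_prop)
        (fun x => by simp only [hper x]) k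
    have h2 : ∀ θ : Fin n → ℝ, antipodalWeight β θ * (1 / n * ∑ k, Real.exp (t * g (θ k))) =
        1 / n * ∑ k, antipodalWeight β θ * Real.exp (t * g (θ k)) := fun θ => by
      rw [← Finset.mul_sum]; ring
    simp_rw [h2]
    rw [integral_const_mul, integral_finsetSum _
      fun k _ => integrableOn_angleCube (by fun_prop)]
    simp_rw [h1]
    simp
    field_simp
  have hA : IntegrableOn
      (fun θ : Fin n → ℝ => antipodalWeight β θ * Real.exp (t / n * ∑ j, g (θ j)))
      (angleCube n) := integrableOn_angleCube (by fun_prop)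
  have hB : IntegrableOn
      (fun θ : Fin n → ℝ => antipodalWeight β θ * (1 / n * ∑ k, Real.exp (t * g (θ k))))
      (angleCube n) := integrableOn_angleCube (by fun_prop)
  have hmain : |(∫ θ in angleCube n, antipodalWeight β θ * Real.exp (t / n * ∑ j, g (θ j))) -
      antipodalZ β n * m| ≤ K * (antipodalZ β n + 2 / ((n : ℝ) ^ 2 * ε) *
        ∫ θ in angleCube n, antipodalWeight β θ * sineEnergy θ) := by
    rw [← hmean, ← integral_sub hA hB]
    refine (abs_integral_le_integral_abs).trans ?_
    have hr : K * (antipodalZ β n + 2 / ((n : ℝ) ^ 2 * ε) *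
        ∫ θ in angleCube n, antipodalWeight β θ * sineEnergy θ) =
        ∫ θ in angleCube n, K * (antipodalWeight β θ +
          2 / ((n : ℝ) ^ 2 * ε) * (antipodalWeight β θ * sineEnergy θ)) := by
      rw [integral_const_mul, integral_add (integrableOn_angleCube hw)
        (integrableOn_angleCube (by fun_prop)), integral_const_mul, antipodalZ]
    rw [hr]
    refine integral_mono (hA.sub hB).abs (integrableOn_angleCube (by fun_prop)) fun θ => ?_
    have h1 := abs_exp_mean_sub_mean_exp_le hper hq1 hg hG ht hε hn θ
    simp only
    rw [← mul_sub, abs_mul, abs_of_nonneg (antipodalWeight_nonneg β θ)]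
    refine (mul_le_mul_of_nonneg_left h1 (antipodalWeight_nonneg β θ)).trans (le_of_eq ?_)
    rw [hK]
    ring
  have hE := integral_weight_mul_sineEnergy_le hβ hn
  rw [integral_antipodalLaw hβ]
  have hd : (∫ θ in angleCube n, antipodalWeight β θ * Real.exp (t / n * ∑ j, g (θ j))) /
      antipodalZ β n - m = ((∫ θ in angleCube n, antipodalWeight β θ *
        Real.exp (t / n * ∑ j, g (θ j))) - antipodalZ β n * m) / antipodalZ β n := by
    field_simp
  rw [hd, abs_div, abs_of_pos hZ, div_le_iff₀ hZ]
  refine hmain.trans ?_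
  rw [mul_assoc K]
  refine mul_le_mul_of_nonneg_left ?_ hK0
  rw [add_mul, one_mul]
  refine add_le_add le_rfl ?_
  calc 2 / ((n : ℝ) ^ 2 * ε) * ∫ θ in angleCube n, antipodalWeight β θ * sineEnergy θ
      = 4 / (β * ((n : ℝ) ^ 2 * ε)) *
        (β / 2 * ∫ θ in angleCube n, antipodalWeight β θ * sineEnergy θ) := by
        field_simp; ring
    _ ≤ 4 / (β * ((n : ℝ) ^ 2 * ε)) *
        ((β + n * Real.log (2 * Real.pi * n) + 1) * antipodalZ β n) := by gcongr
    _ = _ := by ring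

/-! ### Choice of scale and conclusion -/

/-- At scale `ε = n ^ (δ - 1)` the extra `n ^ δ` over `1 / n` absorbs the logarithm in the mean
energy. -/
lemma energy_scale_le {β δ : ℝ} (hβ : 0 < β) (hδ : 0 < δ) {n : ℕ} (hn : 1 ≤ n) :
    4 / (β * ((n : ℝ) ^ 2 * (n : ℝ) ^ (δ - 1))) * (β + n * Real.log (2 * Real.pi * n) + 1) ≤
      4 / β * (β + (2 * Real.pi) ^ δ / δ + 1) := by
  have hn' : (1 : ℝ) ≤ n := by exact_mod_cast hn
  have hn0 : (0 : ℝ) < n := by linarith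
  have hp := Real.pi_pos
  have h1 : (n : ℝ) ^ 2 * (n : ℝ) ^ (δ - 1) = (n : ℝ) * (n : ℝ) ^ δ := by
    rw [Real.rpow_sub_one hn0.ne']; field_simp
  have h2 : Real.log (2 * Real.pi * n) ≤ (2 * Real.pi) ^ δ * (n : ℝ) ^ δ / δ := by
    rw [← Real.mul_rpow (by positivity) hn0.le]
    exact Real.log_le_rpow_div (by positivity) hδ
  have h3 : 1 ≤ (n : ℝ) * (n : ℝ) ^ δ :=
    one_le_mul_of_one_le_of_one_le hn' (Real.one_le_rpow hn' hδ.le)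
  rw [h1]
  have h4 : β + n * Real.log (2 * Real.pi * n) + 1 ≤
      (n : ℝ) * (n : ℝ) ^ δ * (β + (2 * Real.pi) ^ δ / δ + 1) := by
    have h5 := mul_le_mul_of_nonneg_left h2 hn0.le
    have h6 := mul_le_mul_of_nonneg_right h3 (by positivity : 0 ≤ β + 1)
    calc β + n * Real.log (2 * Real.pi * n) + 1
        ≤ (n : ℝ) * (n : ℝ) ^ δ * (β + 1) + n * ((2 * Real.pi) ^ δ * (n : ℝ) ^ δ / δ) := by linarith
      _ = _ := by ring
  calc _ ≤ 4 / (β * ((n : ℝ) * (n : ℝ) ^ δ)) *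
        ((n : ℝ) * (n : ℝ) ^ δ * (β + (2 * Real.pi) ^ δ / δ + 1)) := by gcongr
    _ = _ := by
      have : (n : ℝ) ^ δ ≠ 0 := (Real.rpow_pos_of_pos hn0 _).ne'
      field_simp

theorem theorem1p3 (β : ℝ) (hβ : 0 < β) (g : ℝ → ℝ)
    (hper : Function.Periodic g (2 * Real.pi))
    (q : ℝ≥0) (hq0 : 0 < q) (hq1 : q ≤ 1) (hg : ∃ L : ℝ≥0, HolderWith L q g)
    (ζ : ℝ) (hζ0 : 0 < ζ) (hζ : ζ < (q : ℝ) / 2) :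
    (∀ n : ℕ, 1 ≤ n →
      IsProbabilityMeasure (antipodalLaw β n) ∧
      ∀ t : ℝ,
        Integrable (fun θ : Fin n → ℝ => Real.exp (t / (n : ℝ) * ∑ j : Fin n, g (θ j)))
          (antipodalLaw β n) ∧
        ∫ θ : Fin n → ℝ, Real.exp (t / (n : ℝ) * ∑ j : Fin n, g (θ j)) ∂(antipodalLaw β n) =
          antipodalI β n (fun x => t / (n : ℝ) * g x) / antipodalI β n (fun _ => 0)) ∧
    (∀ K : Set ℝ, IsCompact K →
      ∃ C : ℝ, ∀ᶠ n : ℕ in atTop, ∀ t ∈ K,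
        |∫ θ : Fin n → ℝ, Real.exp (t / (n : ℝ) * ∑ j : Fin n, g (θ j)) ∂(antipodalLaw β n) -
          1 / (2 * Real.pi) * ∫ x in (-Real.pi)..Real.pi, Real.exp (t * g x)| ≤
          C * (n : ℝ) ^ (-ζ)) := by
  obtain ⟨L, hL⟩ := hg
  have hgc : Continuous g := hL.continuous hq0
  obtain ⟨G, hG⟩ := exists_abs_le_of_holder hper hq1 hL
  refine ⟨fun n hn => ?_, fun K hK => ?_⟩
  · have hprob := isProbabilityMeasure_antipodalLaw hβ hn
    refine ⟨hprob, fun t => ⟨?_, ?_⟩⟩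
    · refine Integrable.of_bound (C := Real.exp (|t / n| * (n * G)))
        (Continuous.aestronglyMeasurable (by fun_prop)) (ae_of_all _ fun θ => ?_)
      rw [Real.norm_eq_abs, Real.abs_exp, Real.exp_le_exp]
      refine (le_abs_self _).trans ?_
      rw [abs_mul]
      gcongr
      calc |∑ j, g (θ j)| ≤ ∑ j : Fin n, |g (θ j)| := Finset.abs_sum_le_sum_abs _ _
        _ ≤ ∑ _j : Fin n, G := Finset.sum_le_sum fun j _ => hG _
        _ = n * G := by simp
    · rw [integral_antipodalLaw hβ, antipodalI, antipodalI, antipodalZ]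
      simp only [← Real.exp_sum, ← Finset.mul_sum, Real.exp_zero, Finset.prod_const_one, mul_one]
  · obtain ⟨T, hT⟩ := hK.isBounded.exists_norm_le
    have hq : (0 : ℝ) < q := by exact_mod_cast hq0
    -- Solves `(δ - 1) * q / 2 = -ζ`; positivity of `δ` is exactly `ζ < q / 2`.
    set δ := 1 - 2 * ζ / q with hδ
    have hδ0 : 0 < δ := by
      rw [hδ, sub_pos, div_lt_one hq]
      linarith
    refine ⟨Real.exp (T * G) * T * (L * Real.pi ^ (q : ℝ)) *
      (1 + 4 / β * (β + (2 * Real.pi) ^ δ / δ + 1)), ?_⟩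
    filter_upwards [eventually_ge_atTop 1] with n hn t ht
    have hn0 : (0 : ℝ) < n := by exact_mod_cast hn
    have htT : |t| ≤ T := hT t ht
    have hT0 : 0 ≤ T := (abs_nonneg t).trans htT
    have hε : ((n : ℝ) ^ (δ - 1)) ^ ((q : ℝ) / 2) = (n : ℝ) ^ (-ζ) := by
      rw [← Real.rpow_mul hn0.le]
      congr 1
      rw [hδ]
      field_simp
      ring
    refine (abs_integral_exp_mean_sub_le hβ hper hq0 hq1 hL hG htT
      (Real.rpow_pos_of_pos hn0 (δ - 1)) hn).trans ?_
    have hp := Real.pi_pos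
    rw [hε]
    calc _ ≤ Real.exp (T * G) * T * (L * Real.pi ^ (q : ℝ) * (n : ℝ) ^ (-ζ)) *
          (1 + 4 / β * (β + (2 * Real.pi) ^ δ / δ + 1)) := by
          gcongr _ * (1 + ?_)
          exact energy_scale_le hβ hδ0 hn
      _ = _ := by ring
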